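/- All spaces are Hausdorff. For a compact space $X$ let $C(X)$ be the algebra of continuous complex-valued functions on $X$ with the supremum norm $\|\cdot\|$. Let $A \subseteq C(X)$ be a subalgebra that contains the constant functions and separates the points of $X$. A closed set $H \subseteq X$ is a *boundary* for $A$ if $\sup_{x\in H}|f(x)| = \|f\|$ for all $f \in A$; the *Šilov boundary* $\mathrm{Sh}(A)$ is the smallest closed set that is a boundary for $A$ (equivalently, the intersection of all closed boundaries). A compact space $H$ is *removable* if for every compact space $X$, every open $U \subsetneq X$ whose closure $\overline U$ is homeomorphic to a subspace of $H$, and every subalgebra $A$ of $C(X)$ that is closed, contains the constants, separates points and has no idempotents other than $0$ and $1$, one has $\mathrm{Sh}(A) \subseteq X \setminus U$. The support of a regular complex Borel measure $\mu$ on a compact space $H$ is $\operatorname{supt}(\mu) = H \setminus \bigcup\{U \subseteq H : U \text{ open},\ |\mu|(U) = 0\}$, where $|\mu|$ is the total variation of $\mu$. A compact space $H$ is *pseudo-removable* if $\operatorname{supt}(\mu)$ is removable for every regular complex Borel measure $\mu$ on $H$. **Lemma.** Let $L$ be a linearly ordered set that is compact in its order topology, and suppose that no subspace of $L$ is homeomorphic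 to the Cantor set. Then $L$ is pseudo-removable. -/

import Mathlib

open MeasureTheory Topology

universe u v

namespace FunctionAlgebra

section Boundary

variable {X : Type u} [TopologicalSpace X] [CompactSpace X]

/-- The supremum `‖f‖_H` of `|f|` over `H` (for continuous `f` on a compact space; the value is `0`
when `H` is empty). -/
noncomputable def supNormOn (H : Set X) (f : C(X, ℂ)) : ℝ :=
  ⨆ x : H, ‖f x‖

/-- A closed set `H ⊆ X` is a boundary for `A` if `‖f‖_H = ‖f‖` for every `f ∈ A`. -/
def IsBoundary (A : Subalgebra ℂ C(X, ℂ)) (H : Set X) : Prop :=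
  IsClosed H ∧ ∀ f ∈ A, supNormOn H f = ‖f‖

/-- The Šilov boundary of `A`: the intersection of all (closed) boundaries. When `A` separates the
points of `X` this is itself a boundary, hence the smallest one: see `isLeast_silovBoundary`. -/
def silovBoundary (A : Subalgebra ℂ C(X, ℂ)) : Set X :=
  ⋂₀ {H : Set X | IsBoundary A H}

/-- `A` is a closed subalgebra of `C(X)` that separates the points of `X`. (Like every subalgebra
in the sense of Mathlib, it contains the constant functions.) -/
structure IsFunctionAlgebra (A : Subalgebra ℂ C(X, ℂ)) : Prop where
  separatesPoints : A.SeparatesPoints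
  isClosed : IsClosed (A : Set C(X, ℂ))

/-- Every idempotent of `A` is one of the two constant functions `0` and `1`. -/
def OnlyTrivialIdempotents (A : Subalgebra ℂ C(X, ℂ)) : Prop :=
  ∀ e ∈ A, e * e = e → e = 0 ∨ e = 1

theorem isBoundary_iff (A : Subalgebra ℂ C(X, ℂ)) (H : Set X) :
    IsBoundary A H ↔ IsClosed H ∧ ∀ f ∈ A, ∀ x, ∃ y ∈ H, ‖f x‖ ≤ ‖f y‖ := by
  have bdd : ∀ f : C(X, ℂ), BddAbove (Set.range fun x : H => ‖f x‖) := fun f =>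
    ⟨‖f‖, by rintro _ ⟨y, rfl⟩; exact f.norm_coe_le_norm y⟩
  unfold IsBoundary supNormOn
  refine and_congr_right fun hH => ⟨fun h f hf x => ?_, fun h f hf => ?_⟩
  · have hne : H.Nonempty := by
      by_contra hcon
      have hemp := Set.not_nonempty_iff_eq_empty.1 hcon
      subst hemp
      have h1 := (1 : C(X, ℂ)).norm_coe_le_norm x
      rw [← h 1 A.one_mem] at h1
      norm_num at h1
    obtain ⟨y, hy, hmax⟩ := hH.isCompact.exists_isMaxOn hne (f.continuous.norm.continuousOn)
    refine ⟨y, hy, (f.norm_coe_le_norm x).trans ?_⟩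
    rw [← h f hf]
    have : Nonempty H := hne.to_subtype
    exact ciSup_le fun z => hmax z.2
  · apply le_antisymm
    · exact Real.iSup_le (fun y => f.norm_coe_le_norm y) (norm_nonneg _)
    · refine (f.norm_le (Real.iSup_nonneg fun _ => norm_nonneg _)).2 fun x => ?_
      obtain ⟨y, hy, hxy⟩ := h f hf x
      exact hxy.trans (le_ciSup (bdd f) ⟨y, hy⟩)

/-- If an open set `{|g| < 1 for all g ∈ t}`, `t ⊆ A` finite, misses some boundary, then it can be
removed from every boundary. -/
theorem isBoundary_diff (A : Subalgebra ℂ C(X, ℂ)) (t : Finset C(X, ℂ)) (ht : ∀ g ∈ t, g ∈ A)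
    {F : Set X} (hF : IsBoundary A F) (hFt : ∀ y ∈ F, ∃ g ∈ t, 1 ≤ ‖g y‖)
    {E : Set X} (hE : IsBoundary A E) :
    IsBoundary A (E \ {x | ∀ g ∈ t, ‖g x‖ < 1}) := by
  have hV : IsOpen {x | ∀ g ∈ t, ‖g x‖ < 1} := by
    have : {x | ∀ g ∈ t, ‖g x‖ < 1} = ⋂ g ∈ t, {x | ‖g x‖ < 1} := by ext; simp
    rw [this]
    exact isOpen_biInter_finset fun g _ => isOpen_lt g.continuous.norm continuous_const
  rw [isBoundary_iff] at hF hE ⊢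
  have hcl : IsClosed (E \ {x | ∀ g ∈ t, ‖g x‖ < 1}) := hE.1.sdiff hV
  refine ⟨hcl, ?_⟩
  by_contra! hcon
  obtain ⟨f₀, hf₀, x₀, hx₀⟩ := hcon
  -- normalise so that the maximum modulus is one, attained at a point of `F`
  obtain ⟨x, -, hmax⟩ := isCompact_univ.exists_isMaxOn (s := (Set.univ : Set X))
    ⟨x₀, trivial⟩ f₀.continuous.norm.continuousOn
  have hmax' : ∀ y, ‖f₀ y‖ ≤ ‖f₀ x‖ := fun y => hmax (Set.mem_univ y)
  obtain ⟨z, hzF, hz⟩ := hF.2 f₀ hf₀ x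
  have hzx : ‖f₀ z‖ = ‖f₀ x‖ := le_antisymm (hmax' z) hz
  obtain ⟨g, hgt, hg⟩ := hFt z hzF
  have hM : ∀ y ∈ E \ {x | ∀ g ∈ t, ‖g x‖ < 1}, ‖f₀ y‖ < ‖f₀ x‖ := fun y hy =>
    (hx₀ y hy).trans_le (hmax' x₀)
  have hx0 : 0 < ‖f₀ x‖ := by
    rcases (norm_nonneg (f₀ x)).eq_or_lt with h0 | h0
    · exfalso
      obtain ⟨y, hyE, -⟩ := hE.2 1 A.one_mem x
      obtain ⟨w, hwE, hw⟩ := hE.2 g (ht g hgt) z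
      exact absurd (hM w ⟨hwE, fun h => by linarith [h g hgt]⟩)
        (by rw [← h0]; exact not_lt.2 (norm_nonneg _))
    · exact h0
  -- a uniform ratio `r < 1` on the smaller set
  obtain ⟨r, hr0, hr1, hr⟩ : ∃ r : ℝ, 0 ≤ r ∧ r < 1 ∧
      ∀ y ∈ E \ {x | ∀ g ∈ t, ‖g x‖ < 1}, ‖f₀ y‖ ≤ r * ‖f₀ x‖ := by
    rcases (E \ {x | ∀ g ∈ t, ‖g x‖ < 1}).eq_empty_or_nonempty with h | h
    · exact ⟨0, le_rfl, zero_lt_one, by rw [h]; simp⟩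
    · obtain ⟨y, hy, hym⟩ := hcl.isCompact.exists_isMaxOn h f₀.continuous.norm.continuousOn
      refine ⟨‖f₀ y‖ / ‖f₀ x‖, by positivity, (div_lt_one hx0).2 (hM y hy), fun w hw => ?_⟩
      rw [div_mul_cancel₀ _ hx0.ne']
      exact hym hw
  obtain ⟨n, hn⟩ : ∃ n : ℕ, r ^ n * (‖g‖ + 1) < 1 := by
    obtain ⟨n, hn⟩ := exists_pow_lt_of_lt_one (y := r) (x := (‖g‖ + 1)⁻¹) (by positivity) hr1
    refine ⟨n, ?_⟩
    have h1 : 0 < ‖g‖ + 1 := by positivity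
    calc r ^ n * (‖g‖ + 1) < (‖g‖ + 1)⁻¹ * (‖g‖ + 1) := mul_lt_mul_of_pos_right hn h1
      _ = 1 := inv_mul_cancel₀ h1.ne'
  obtain ⟨w, hwE, hw⟩ := hE.2 (f₀ ^ n * g) (A.mul_mem (A.pow_mem hf₀ n) (ht g hgt)) z
  have hpos : 0 < ‖f₀ x‖ ^ n := pow_pos hx0 n
  have hw' : ‖f₀ x‖ ^ n * 1 ≤ ‖f₀ w‖ ^ n * ‖g w‖ := by
    calc ‖f₀ x‖ ^ n * 1 ≤ ‖f₀ z‖ ^ n * ‖g z‖ := by rw [hzx]; gcongr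
      _ ≤ _ := by simpa using hw
  by_cases hwV : w ∈ {x | ∀ g ∈ t, ‖g x‖ < 1}
  · have h1 : ‖f₀ w‖ ^ n * ‖g w‖ ≤ ‖f₀ x‖ ^ n * ‖g w‖ := by gcongr; exact hmax' w
    have h2 : ‖f₀ x‖ ^ n * ‖g w‖ < ‖f₀ x‖ ^ n * 1 := mul_lt_mul_of_pos_left (hwV g hgt) hpos
    linarith
  · have h1 : ‖f₀ w‖ ^ n * ‖g w‖ ≤ (r * ‖f₀ x‖) ^ n * (‖g‖ + 1) := by
      gcongr
      · exact hr w ⟨hwE, hwV⟩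
      · linarith [g.norm_coe_le_norm w]
    have h2 : (r * ‖f₀ x‖) ^ n * (‖g‖ + 1) = ‖f₀ x‖ ^ n * (r ^ n * (‖g‖ + 1)) := by ring
    have h3 : ‖f₀ x‖ ^ n * (r ^ n * (‖g‖ + 1)) < ‖f₀ x‖ ^ n * 1 := mul_lt_mul_of_pos_left hn hpos
    linarith

/-- The Šilov boundary is the smallest closed set that is a boundary. -/
theorem isLeast_silovBoundary (A : Subalgebra ℂ C(X, ℂ)) (hA : A.SeparatesPoints) :
    IsLeast {H : Set X | IsBoundary A H} (silovBoundary A) := by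
  refine ⟨?_, fun H hH => Set.sInter_subset_of_mem hH⟩
  rw [Set.mem_ofPred_eq, isBoundary_iff]
  refine ⟨isClosed_sInter fun H hH => hH.1, ?_⟩
  by_contra! hcon
  obtain ⟨f, hf, x₀, hx₀⟩ := hcon
  have hK : IsCompact {x : X | ‖f x₀‖ ≤ ‖f x‖} :=
    (isClosed_le continuous_const f.continuous.norm).isCompact
  -- each point of this compact set has a neighbourhood that can be removed from any boundary
  have key : ∀ x ∈ {x : X | ‖f x₀‖ ≤ ‖f x‖}, ∃ V ∈ 𝓝 x, ∀ E, IsBoundary A E →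
      ∃ E', IsBoundary A E' ∧ E' ⊆ E \ V := by
    intro x hx
    have hxS : x ∉ silovBoundary A := fun h => not_le.2 (hx₀ x h) hx
    obtain ⟨F, hF, hxF⟩ : ∃ F, IsBoundary A F ∧ x ∉ F := by
      simpa [silovBoundary, Set.mem_sInter] using hxS
    have hg : ∀ y ∈ F, ∃ g ∈ A, g x = 0 ∧ 1 < ‖g y‖ := by
      intro y hy
      obtain ⟨_, ⟨k, hk, rfl⟩, hne⟩ := hA (show x ≠ y from fun h => hxF (h ▸ hy))
      have hne' : k y - k x ≠ 0 := sub_ne_zero.2 (Ne.symm hne)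
      refine ⟨(2 / (k y - k x)) • (k - (k x) • (1 : C(X, ℂ))),
        A.smul_mem (A.sub_mem hk (A.smul_mem A.one_mem _)) _, by simp, ?_⟩
      have : (2 / (k y - k x)) * (k y - k x) = 2 := div_mul_cancel₀ _ hne'
      simp only [ContinuousMap.coe_smul, Pi.smul_apply, ContinuousMap.coe_sub, Pi.sub_apply,
        ContinuousMap.one_apply, smul_eq_mul, mul_one]
      rw [this]; norm_num
    choose! g hgA hgx hgy using hg
    obtain ⟨s, hs⟩ := hF.1.isCompact.elim_nhds_subcover' (fun y _ => {w | 1 < ‖g y w‖})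
      (fun y hy => (isOpen_lt continuous_const (g y).continuous.norm).mem_nhds (hgy y hy))
    classical
    let t : Finset C(X, ℂ) := s.image fun y : F => g y
    have htA : ∀ h ∈ t, h ∈ A := by
      intro h hh
      obtain ⟨y, -, rfl⟩ := Finset.mem_image.1 hh
      exact hgA y y.2
    have htx : ∀ h ∈ t, h x = 0 := by
      intro h hh
      obtain ⟨y, -, rfl⟩ := Finset.mem_image.1 hh
      exact hgx y y.2
    refine ⟨{w | ∀ h ∈ t, ‖h w‖ < 1}, ?_, fun E hE =>
      ⟨_, isBoundary_diff A t htA hF (fun y hy => ?_) hE, subset_rfl⟩⟩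
    · have hVo : IsOpen {w | ∀ h ∈ t, ‖h w‖ < 1} := by
        have : {w | ∀ h ∈ t, ‖h w‖ < 1} = ⋂ h ∈ t, {w | ‖h w‖ < 1} := by ext; simp
        rw [this]
        exact isOpen_biInter_finset fun h _ => isOpen_lt h.continuous.norm continuous_const
      exact hVo.mem_nhds fun h hh => by rw [htx h hh]; simp
    · obtain ⟨z, hz, hzy⟩ := Set.mem_iUnion₂.1 (hs hy)
      exact ⟨g z, Finset.mem_image_of_mem _ hz, le_of_lt hzy⟩
  choose! V hV hVE using key
  obtain ⟨s, hsK, hs⟩ := hK.elim_nhds_subcover V hV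
  have hrem : ∀ s : Finset X, (∀ x ∈ s, x ∈ {x : X | ‖f x₀‖ ≤ ‖f x‖}) →
      ∃ E, IsBoundary A E ∧ ∀ x ∈ s, Disjoint E (V x) := by
    classical
    intro s
    induction s using Finset.induction_on with
    | empty =>
      exact fun _ => ⟨Set.univ, (isBoundary_iff A _).2
        ⟨isClosed_univ, fun f _ x => ⟨x, trivial, le_rfl⟩⟩, by simp⟩
    | insert a s _ ih =>
      intro h
      obtain ⟨E, hE, hd⟩ := ih fun x hx => h x (Finset.mem_insert_of_mem hx)
      obtain ⟨E', hE', hsub⟩ := hVE a (h a (Finset.mem_insert_self a s)) E hE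
      refine ⟨E', hE', fun x hx => ?_⟩
      rcases Finset.mem_insert.1 hx with rfl | hx
      · exact Set.disjoint_left.2 fun y hy => (hsub hy).2
      · exact (hd x hx).mono_left fun y hy => (hsub hy).1
  obtain ⟨E, hE, hd⟩ := hrem s hsK
  obtain ⟨y, hyE, hy⟩ := ((isBoundary_iff A E).1 hE).2 f hf x₀
  obtain ⟨x, hx, hyx⟩ := Set.mem_iUnion₂.1 (hs hy)
  exact Set.disjoint_left.1 (hd x hx) hyE hyx

end Boundary

/-- A compact Hausdorff space `H` is removable if for every compact Hausdorff space `X`, every open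
proper subset `U` of `X` whose closure is homeomorphic to a subspace of `H`, and every closed
separating subalgebra `A` of `C(X)` with only trivial idempotents, the Šilov boundary of `A` is
contained in `X \ U`. -/
def IsRemovable (H : Type u) [TopologicalSpace H] : Prop :=
  CompactSpace H ∧ T2Space H ∧
    ∀ (X : Type v) [TopologicalSpace X] [CompactSpace X] [T2Space X]
      (U : Set X) (A : Subalgebra ℂ C(X, ℂ)),
      IsOpen U → U ≠ Set.univ →
      (∃ K : Set H, Nonempty (closure U ≃ₜ K)) →
      IsFunctionAlgebra A → OnlyTrivialIdempotents A →
      silovBoundary A ⊆ Uᶜ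

/-- The support of a complex Borel measure is the closed support of its total variation `|μ|`, that
is, the complement of the union of all open `|μ|`-null sets. -/
noncomputable def complexSupport {H : Type u} [TopologicalSpace H] [MeasurableSpace H]
    (μ : ComplexMeasure H) : Set H :=
  μ.variation.support

/-- A compact Hausdorff space `H` is pseudo-removable if the support of every regular complex Borel
measure on `H` is removable. -/
def IsPseudoRemovable (H : Type u) [TopologicalSpace H] [MeasurableSpace H] [BorelSpace H] : Prop :=
  CompactSpace H ∧ T2Space H ∧
    ∀ μ : ComplexMeasure H, μ.variation.Regular → IsRemovable.{u, v} (complexSupport μ)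

/-- Some subset of `H` is homeomorphic to the Cantor set. -/
def ContainsCantorSubset (H : Type u) [TopologicalSpace H] : Prop :=
  ∃ K : Set H, Nonempty (K ≃ₜ cantorSet)

end FunctionAlgebra

/-! Suppose the Šilov boundary meets `U`. Restricting `A` to this boundary is isometric, and
minimality then makes every nonempty open set contain a point where some member of the algebra
exceeds in modulus all its values outside (`peaksEverywhere_restrict_silovBoundary`). A member whose
real part omits a value but lies on both sides of it would yield a nontrivial idempotent
(`OnlyTrivialIdempotents.re_lt_or_lt`). Hence no point of the open set is isolated, and its closure
`K` is perfect.

Now `K` inherits an order from `L`, and the distribution function of `|μ|` increases strictly across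
nonadjacent points. It provides countably many continuous functions, that is, a map `π` into a
Polish space that identifies at most adjacent points ("twins"). If some nonempty open set held only
countably many twins, countably many further functions would make `π` injective there, and a perfect
compact metrizable subset would contain a Cantor set. So twins are uncountable in every nonempty
open set (`not_countable_twins`).

For uncountably many twins `p` the algebra contains a function `h p` with a unit jump across `p`
that is small off the open set (`exists_unit_jump`). Near each fibre of `π` a continuous function is
governed by at most two values, so countably many descriptions suffice for all `h p`, and two of
them share one. The real part of their difference omits some `c` in `(1/2, 3/4)`, exceeds `c`
somewhere and stays below `c` off the open set (`exists_sub_omits_value`), which is impossible. -/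

namespace FunctionAlgebra

/-! ### Idempotents from functions whose real part omits a value -/

section Idempotents

variable {X : Type*} [TopologicalSpace X] [CompactSpace X]

/-- In a closed subalgebra of `C(X)`, a function whose real part has no zero is invertible. -/
theorem isUnit_of_re_ne_zero {A : Subalgebra ℂ C(X, ℂ)} (hA : IsClosed (A : Set C(X, ℂ))) (f : A)
    (hf : ∀ x, ((f : C(X, ℂ)) x).re ≠ 0) : IsUnit f := by
  rw [← spectrum.zero_notMem_iff ℂ]
  intro h0
  have hline : IsPreconnected (Set.range fun t : ℝ => (t : ℂ) * Complex.I) :=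
    isPreconnected_range (by fun_prop)
  have hsub : (Set.range fun t : ℝ => (t : ℂ) * Complex.I) ⊆ (spectrum ℂ (f : C(X, ℂ)))ᶜ := by
    rintro _ ⟨t, rfl⟩ ht
    rw [ContinuousMap.spectrum_eq_range] at ht
    obtain ⟨x, hx⟩ := ht
    exact hf x (by rw [hx]; simp)
  -- Passing to a closed subalgebra can only fill bounded components of the complement of the
  -- spectrum, but the component of `0` contains the whole imaginary axis.
  have hb := (Subalgebra.spectrum_isBounded_connectedComponentIn (hS := hA) A f h0).subset
    (hline.subset_connectedComponentIn ⟨0, by simp⟩ hsub)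
  obtain ⟨R, hR⟩ := hb.exists_norm_le
  have := hR _ ⟨|R| + 1, rfl⟩
  simp only [norm_mul, Complex.norm_I, mul_one, Complex.norm_real, Real.norm_eq_abs] at this
  have h2 := le_abs_self (|R| + 1)
  linarith [le_abs_self R]

/-- One step of Newton's iteration for the matrix sign function contracts towards `s = ±1`. -/
theorem newton_sign_step {z s : ℂ} (hz : z ≠ 0) (hs : s * s = 1) {r : ℝ}
    (h : ‖z - s‖ ≤ r * ‖z + s‖) :
    ‖(z + z⁻¹) / 2 - s‖ ≤ r ^ 2 * ‖(z + z⁻¹) / 2 + s‖ := by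
  -- Because `s² = 1`, both differences become squares over `2z`, so their ratio is squared.
  have h1 : (z + z⁻¹) / 2 - s = (z - s) ^ 2 / (2 * z) := by
    field_simp
    linear_combination -hs
  have h2 : (z + z⁻¹) / 2 + s = (z + s) ^ 2 / (2 * z) := by
    field_simp
    linear_combination -hs
  rw [h1, h2, norm_div, norm_div, norm_pow, norm_pow, ← mul_div_assoc, ← mul_pow]
  gcongr

/-- The step multiplies the real part by the positive factor `(1 + |z|⁻²) / 2`. This keeps the
iterates invertible in `A`. -/
theorem newton_sign_re_ne_zero {z : ℂ} (hz : z.re ≠ 0) : ((z + z⁻¹) / 2).re ≠ 0 := by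
  have h0 : 0 < Complex.normSq z := Complex.normSq_pos.2 fun h => hz (by simp [h])
  have : ((z + z⁻¹) / 2).re = z.re * ((1 + (Complex.normSq z)⁻¹) / 2) := by
    rw [show (z + z⁻¹) / 2 = ((1 / 2 : ℝ) : ℂ) * (z + z⁻¹) by push_cast; ring, Complex.re_ofReal_mul]
    simp [Complex.inv_re]
    ring
  rw [this]
  exact mul_ne_zero hz (by positivity)

/-- If `f ∈ A` has real part without zeros, then the sign of the real part belongs to `A`. -/
theorem sign_mem {A : Subalgebra ℂ C(X, ℂ)} (hA : IsClosed (A : Set C(X, ℂ))) {f σ : C(X, ℂ)}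
    (hfA : f ∈ A) (hσ : ∀ x, (0 < (f x).re ∧ σ x = 1) ∨ ((f x).re < 0 ∧ σ x = -1)) : σ ∈ A := by
  rcases isEmpty_or_nonempty X with hX | hX
  · rwa [Subsingleton.elim σ f]
  have hσσ : ∀ x, σ x * σ x = 1 := fun x => by rcases hσ x with h | h <;> simp [h.2]
  have hlt : ∀ x, ‖f x - σ x‖ < ‖f x + σ x‖ := by
    intro x
    rw [← sq_lt_sq₀ (norm_nonneg _) (norm_nonneg _), ← Complex.normSq_eq_norm_sq,
      ← Complex.normSq_eq_norm_sq]
    rcases hσ x with h | h <;> rw [h.2] <;> simp [Complex.normSq_apply] <;> nlinarith [h.1]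
  have hpos : ∀ x, 0 < ‖f x + σ x‖ := fun x => (norm_nonneg _).trans_lt (hlt x)
  obtain ⟨x₀, -, hx₀⟩ := isCompact_univ.exists_isMaxOn (s := (Set.univ : Set X)) Set.univ_nonempty
    (f := fun x => ‖f x - σ x‖ / ‖f x + σ x‖)
    (Continuous.continuousOn (by
      have := fun x => (hpos x).ne'
      fun_prop (disch := assumption)))
  set r := ‖f x₀ - σ x₀‖ / ‖f x₀ + σ x₀‖ with hr
  have hr0 : 0 ≤ r := by positivity
  have hr1 : r < 1 := (div_lt_one (hpos x₀)).2 (hlt x₀)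
  have key : ∀ n : ℕ, ∃ g ∈ A, ∀ x, (g x).re ≠ 0 ∧ ‖g x - σ x‖ ≤ r ^ 2 ^ n * ‖g x + σ x‖ := by
    intro n
    induction n with
    | zero =>
      refine ⟨f, hfA, fun x => ⟨?_, ?_⟩⟩
      · rcases hσ x with h | h
        · exact h.1.ne'
        · exact h.1.ne
      · rw [pow_zero, pow_one, ← div_le_iff₀ (hpos x)]
        exact hx₀ (Set.mem_univ x)
    | succ n ih =>
      obtain ⟨g, hgA, hg⟩ := ih
      obtain ⟨w, hw⟩ := isUnit_of_re_ne_zero hA ⟨g, hgA⟩ fun x => (hg x).1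
      have hinv : ∀ x, ((w⁻¹ : Aˣ) : A).1 x = (g x)⁻¹ := by
        intro x
        have h1 : ((w : A) * ((w⁻¹ : Aˣ) : A)).1 x = 1 := by rw [Units.mul_inv]; simp
        rw [hw] at h1
        exact eq_inv_of_mul_eq_one_right h1
      refine ⟨(1 / 2 : ℂ) • (g + ((w⁻¹ : Aˣ) : A).1), A.smul_mem (A.add_mem hgA (Subtype.mem _)) _,
        fun x => ?_⟩
      have hval : ((1 / 2 : ℂ) • (g + ((w⁻¹ : Aˣ) : A).1)) x = (g x + (g x)⁻¹) / 2 := by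
        simp only [ContinuousMap.coe_smul, Pi.smul_apply, ContinuousMap.coe_add, Pi.add_apply,
          hinv, smul_eq_mul]
        ring
      rw [hval, pow_succ 2 n, pow_mul]
      exact ⟨newton_sign_re_ne_zero (hg x).1,
        newton_sign_step (fun h => (hg x).1 (by simp [h])) (hσσ x) (hg x).2⟩
  rw [← SetLike.mem_coe, ← hA.closure_eq, Metric.mem_closure_iff]
  intro ε hε
  -- With `d = ‖g x - σ x‖` and `ρ = r ^ 2 ^ n`, the bounds `d ≤ ρ (d + 2)` and `ρ < 1/2` give `d ≤
  -- 4ρ < ε/2`.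
  obtain ⟨n, hn⟩ := exists_pow_lt_of_lt_one (show 0 < min (1 / 2) (ε / 8) by positivity) hr1
  obtain ⟨g, hgA, hg⟩ := key n
  refine ⟨g, hgA, ?_⟩
  have hρ : r ^ 2 ^ n < min (1 / 2) (ε / 8) :=
    (pow_le_pow_of_le_one hr0 hr1.le n.lt_two_pow_self.le).trans_lt hn
  have hρ0 : 0 ≤ r ^ 2 ^ n := by positivity
  rw [lt_min_iff] at hρ
  refine lt_of_le_of_lt ((ContinuousMap.dist_le (by positivity : 0 ≤ ε / 2)).2 fun x => ?_)
    (half_lt_self hε)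
  rw [dist_comm, dist_eq_norm]
  have h1 := (hg x).2
  have h2 : ‖g x + σ x‖ ≤ ‖g x - σ x‖ + 2 := by
    have hσ1 : ‖σ x‖ = 1 := by rcases hσ x with h | h <;> simp [h.2]
    calc ‖g x + σ x‖ = ‖(g x - σ x) + (σ x + σ x)‖ := by ring_nf
      _ ≤ ‖g x - σ x‖ + (‖σ x‖ + ‖σ x‖) :=
        (norm_add_le _ _).trans (by gcongr; exact norm_add_le _ _)
      _ = _ := by rw [hσ1]; norm_num
  nlinarith [norm_nonneg (g x - σ x), mul_le_mul_of_nonneg_left h2 hρ0]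

/-- In a closed algebra without nontrivial idempotents, the real part of a function that omits a
value stays on one side of it. -/
theorem OnlyTrivialIdempotents.re_lt_or_lt {A : Subalgebra ℂ C(X, ℂ)}
    (hI : OnlyTrivialIdempotents A) (hA : IsClosed (A : Set C(X, ℂ))) {f : C(X, ℂ)} (hfA : f ∈ A)
    {c : ℝ} (hc : ∀ x, (f x).re ≠ c) : (∀ x, (f x).re < c) ∨ ∀ x, c < (f x).re := by
  classical
  have hcl : IsClopen {x | c < (f x).re} := by
    refine ⟨?_, isOpen_lt continuous_const (by fun_prop)⟩
    have : {x | c < (f x).re} = {x | c ≤ (f x).re} := by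
      ext x
      simp only [Set.mem_ofPred_eq]
      exact ⟨le_of_lt, fun h => lt_of_le_of_ne h (hc x).symm⟩
    rw [this]
    exact isClosed_le continuous_const (by fun_prop)
  let e : C(X, ℂ) := ⟨fun x => if c < (f x).re then 1 else 0,
    continuous_const.if (fun x hx => by rw [hcl.frontier_eq] at hx; exact hx.elim) continuous_const⟩
  -- `2e - 1` is the sign of the real part of `f - c`.
  have he : (2 : ℂ) • e - 1 ∈ A := by
    refine sign_mem hA (A.sub_mem hfA (A.smul_mem A.one_mem (c : ℂ))) fun x => ?_
    rcases lt_or_gt_of_ne (hc x) with h | h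
    · right
      simp [e, h, h.le]
    · left
      simp [e, h]
      norm_num
  have heA : e ∈ A := by
    have := A.smul_mem (A.add_mem he A.one_mem) (1 / 2 : ℂ)
    simpa using this
  rcases hI e heA (by ext x; simp [e]) with h | h
  · left
    intro x
    have hx := congrArg (fun g : C(X, ℂ) => g x) h
    by_contra hcon
    have : c < (f x).re := lt_of_le_of_ne (not_lt.1 hcon) (hc x).symm
    simp [e, this] at hx
  · right
    intro x
    have hx := congrArg (fun g : C(X, ℂ) => g x) h
    by_contra hcon
    simp [e, hcon] at hx

end Idempotents

/-- For a continuous map `π` on a compact space, every neighbourhood of a fibre contains a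
saturated one. -/
theorem exists_preimage_subset {K M : Type*} [TopologicalSpace K] [TopologicalSpace M]
    [CompactSpace K] [T2Space M] {π : K → M} (hπc : Continuous π) {y : K} {W : Set K} (hW : IsOpen W)
    (hyW : ∀ z, π z = π y → z ∈ W) : ∃ V : Set M, IsOpen V ∧ π y ∈ V ∧ π ⁻¹' V ⊆ W := by
  refine ⟨(π '' Wᶜ)ᶜ, (hW.isClosed_compl.isCompact.image hπc).isClosed.isOpen_compl, ?_, ?_⟩
  · rintro ⟨z, hz, hzy⟩
    exact hz (hyW z hzy)
  · intro z hz
    by_contra hcon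
    exact hz ⟨z, hcon, rfl⟩

/-! ### Twins: adjacent points with the same image, and jumps across them -/

section Twins

variable {K M : Type*} [LinearOrder K]

/-- The pairs `p.1 < p.2` of points that are identified by `π`. -/
def twins (π : K → M) : Set (K × K) := {p | p.1 < p.2 ∧ π p.1 = π p.2}

/-- The hypothesis on `π` lets only adjacent points be identified, so twins bound a gap of the
order. -/
theorem twins_le_or_le {π : K → M} (hπ : ∀ x y z, x < y → y < z → π x ≠ π z) {p : K × K}
    (hp : p ∈ twins π) (y : K) : y ≤ p.1 ∨ p.2 ≤ y := by
  by_contra! h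
  exact hπ _ _ _ h.1 h.2 hp.2

theorem twins_ext_fst {π : K → M} (hπ : ∀ x y z, x < y → y < z → π x ≠ π z) {p q : K × K}
    (hp : p ∈ twins π) (hq : q ∈ twins π) (h : p.1 = q.1) : p = q := by
  refine Prod.ext h (le_antisymm ?_ ?_)
  · exact (twins_le_or_le hπ hp q.2).resolve_left (not_le.2 (h ▸ hq.1))
  · exact (twins_le_or_le hπ hq p.2).resolve_left (not_le.2 (h ▸ hp.1))

/-- Every fibre of `π` consists of a point and at most one twin. -/
theorem exists_twin {π : K → M} (hπ : ∀ x y z, x < y → y < z → π x ≠ π z) (y : K) :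
    ∃ y', (y' = y ∨ (y, y') ∈ twins π ∨ (y', y) ∈ twins π) ∧
      ∀ z, π z = π y → z = y ∨ z = y' := by
  by_cases h : ∃ y', y' ≠ y ∧ π y' = π y
  · obtain ⟨y', hne, hy'⟩ := h
    have ht : (y, y') ∈ twins π ∨ (y', y) ∈ twins π := by
      rcases lt_or_gt_of_ne hne with h | h
      · exact Or.inr ⟨h, hy'⟩
      · exact Or.inl ⟨h, hy'.symm⟩
    refine ⟨y', Or.inr ht, fun z hz => ?_⟩
    by_contra! hcon
    rcases lt_or_gt_of_ne hcon.1 with hzy | hzy <;> rcases ht with ht | ht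
    · exact hπ _ _ _ hzy ht.1 (hz.trans hy'.symm)
    · have h1 : (z, y) ∈ twins π := ⟨hzy, hz⟩
      rcases lt_or_gt_of_ne hcon.2 with h | h
      · exact hπ _ _ _ h ht.1 hz
      · exact hπ _ _ _ h hzy hy'
    · rcases lt_or_gt_of_ne hcon.2 with h | h
      · exact hπ _ _ _ hzy h hy'.symm
      · exact hπ _ _ _ ht.1 h hz.symm
    · exact hπ _ _ _ ht.1 hzy (hy'.trans hz.symm)
  · push Not at h
    exact ⟨y, Or.inl rfl, fun z hz => Or.inl (by_contra fun hne => h z hne hz)⟩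

variable [TopologicalSpace K] [TopologicalSpace M] [CompactSpace K] [T2Space M]
  [OrderClosedTopology K]

/-- The fibre through `p` is exactly `{p.1, p.2}`, so a saturated neighbourhood of it splits at the
gap. Near twins a continuous function is thus governed by one value on each side. -/
theorem exists_twin_nhds {π : K → M} (hπc : Continuous π)
    (hπ : ∀ x y z, x < y → y < z → π x ≠ π z) {p : K × K} (hp : p ∈ twins π) {W W' : Set K}
    (hW : IsOpen W) (hW' : IsOpen W') (hpW : p.1 ∈ W) (hpW' : p.2 ∈ W') :
    ∃ V : Set M, IsOpen V ∧ π p.1 ∈ V ∧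
      ∀ z, π z ∈ V → (z ≤ p.1 → z ∈ W) ∧ (p.2 ≤ z → z ∈ W') := by
  obtain ⟨V, hV, hyV, hVW⟩ := exists_preimage_subset hπc (y := p.1)
    (W := (W ∩ Set.Iio p.2) ∪ (W' ∩ Set.Ioi p.1))
    ((hW.inter isOpen_Iio).union (hW'.inter isOpen_Ioi)) (fun z hz => by
      rcases twins_le_or_le hπ hp z with h | h
      · rcases h.eq_or_lt with rfl | h
        · exact Or.inl ⟨hpW, hp.1⟩
        · exact absurd (hz.trans hp.2) (hπ _ _ _ h hp.1)
      · rcases h.eq_or_lt with rfl | h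
        · exact Or.inr ⟨hpW', hp.1⟩
        · exact absurd hz.symm (hπ _ _ _ hp.1 h))
  refine ⟨V, hV, hyV, fun z hz => ⟨fun h => ?_, fun h => ?_⟩⟩
  · exact ((hVW hz).resolve_right fun h' => not_lt.2 h h'.2).1
  · exact ((hVW hz).resolve_left fun h' => not_lt.2 h h'.2).1

/-- A continuous function has only finitely many large jumps. -/
theorem finite_jumps {π : K → M} (hπc : Continuous π) (hπ : ∀ x y z, x < y → y < z → π x ≠ π z)
    {E : Type*} [PseudoMetricSpace E] {h : K → E} (hh : Continuous h) {ε : ℝ} (hε : 0 < ε) :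
    {p | p ∈ twins π ∧ ε ≤ dist (h p.1) (h p.2)}.Finite := by
  have hopen : ∀ a : K, IsOpen {w | dist (h w) (h a) < ε / 2} := fun a =>
    isOpen_lt (by fun_prop) continuous_const
  have hself : ∀ a : K, a ∈ {w | dist (h w) (h a) < ε / 2} := fun a => by simpa using hε
  -- Near `q`, any other twins lie on one side of the gap, where `h` is within `ε / 2` of a single
  -- value; only `q` itself can jump by `ε`.
  have htwin : ∀ q ∈ twins π, ∃ V : Set M, IsOpen V ∧ π q.1 ∈ V ∧ ∀ p ∈ twins π, π p.1 ∈ V →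
      ε ≤ dist (h p.1) (h p.2) → p = q := by
    intro q hq
    obtain ⟨V, hV, hqV, hVW⟩ := exists_twin_nhds hπc hπ hq (hopen q.1) (hopen q.2) (hself _)
      (hself _)
    refine ⟨V, hV, hqV, fun p hp hpV hpε => ?_⟩
    have hpV' : π p.2 ∈ V := hp.2 ▸ hpV
    have hclose : ∀ a, dist (h p.1) (h a) < ε / 2 → dist (h p.2) (h a) < ε / 2 → False := by
      intro a h1 h2
      have := dist_triangle_right (h p.1) (h p.2) (h a)
      linarith
    rcases twins_le_or_le hπ hq p.1 with h1 | h1 <;> rcases twins_le_or_le hπ hq p.2 with h2 | h2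
    · exact (hclose q.1 ((hVW _ hpV).1 h1) ((hVW _ hpV').1 h2)).elim
    · refine twins_ext_fst hπ hp hq (le_antisymm h1 ?_)
      exact (twins_le_or_le hπ hp q.1).resolve_right (not_le.2 (hq.1.trans_le h2))
    · exact absurd hp.1 (not_lt.2 (h2.trans (hq.1.le.trans h1)))
    · exact (hclose q.2 ((hVW _ hpV).2 h1) ((hVW _ hpV').2 h2)).elim
  have key : ∀ y : K, ∃ V : Set M, IsOpen V ∧ π y ∈ V ∧
      {p | p ∈ twins π ∧ π p.1 ∈ V ∧ ε ≤ dist (h p.1) (h p.2)}.Finite := by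
    intro y
    obtain ⟨y', rfl | hy' | hy', hfib⟩ := exists_twin hπ y
    · obtain ⟨V, hV, hyV, hVW⟩ := exists_preimage_subset hπc (hopen y') (y := y')
        (fun z hz => by rcases hfib z hz with rfl | rfl <;> exact hself _)
      refine ⟨V, hV, hyV, Set.Finite.subset Set.finite_empty ?_⟩
      rintro p ⟨hp, hpV, hpε⟩
      have h1 : dist (h p.1) (h y') < ε / 2 := hVW hpV
      have h2 : dist (h p.2) (h y') < ε / 2 := hVW (show π p.2 ∈ V from hp.2 ▸ hpV)
      have := dist_triangle_right (h p.1) (h p.2) (h y')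
      exact absurd hpε (by linarith)
    · obtain ⟨V, hV, hyV, hVW⟩ := htwin _ hy'
      exact ⟨V, hV, hyV, (Set.finite_singleton (y, y')).subset fun p hp => hVW p hp.1 hp.2.1 hp.2.2⟩
    · obtain ⟨V, hV, hyV, hVW⟩ := htwin _ hy'
      exact ⟨V, hV, hy'.2 ▸ hyV,
        (Set.finite_singleton (y', y)).subset fun p hp => hVW p hp.1 hp.2.1 hp.2.2⟩
  choose V hV hyV hfin using key
  obtain ⟨s, hs⟩ := isCompact_univ.elim_finite_subcover (fun y => π ⁻¹' V y)
    (fun y => (hV y).preimage hπc) fun y _ => Set.mem_iUnion.2 ⟨y, hyV y⟩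
  refine (s.finite_toSet.biUnion fun y _ => hfin y).subset ?_
  rintro p ⟨hp, hpε⟩
  obtain ⟨y, hy, hpy⟩ := Set.mem_iUnion₂.1 (hs (Set.mem_univ p.1))
  exact Set.mem_biUnion hy ⟨hp, hpy, hpε⟩

/-- A continuous function has only countably many jumps. -/
theorem countable_jumps {π : K → M} (hπc : Continuous π)
    (hπ : ∀ x y z, x < y → y < z → π x ≠ π z) {E : Type*} [MetricSpace E] {h : K → E}
    (hh : Continuous h) : {p | p ∈ twins π ∧ h p.1 ≠ h p.2}.Countable := by
  refine (Set.countable_iUnion fun n : ℕ => (finite_jumps hπc hπ hh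
    (Nat.one_div_pos_of_nat (n := n) (α := ℝ))).countable).mono ?_
  rintro p ⟨hp, hne⟩
  obtain ⟨n, hn⟩ := exists_nat_one_div_lt (dist_pos.2 hne)
  exact Set.mem_iUnion.2 ⟨n, hp, hn.le⟩

open TopologicalSpace in
/-- A finite amount of countable information about a continuous function `h`: a cover of `K` on
whose members `h` is known up to two alternatives, finely enough for differences of admissible
values to avoid some number in `(1/2, 3/4)`. -/
theorem exists_cover_of_jumps [SecondCountableTopology M] {π : K → M} (hπc : Continuous π)
    (hπ : ∀ x y z, x < y → y < z → π x ≠ π z) {h : K → ℝ} (hh : Continuous h) :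
    ∃ (c : ℚ) (D : Finset (countableBasis M × countableBasis ℝ × countableBasis ℝ)),
      1 / 2 < (c : ℝ) ∧ (c : ℝ) < 3 / 4 ∧
      (∀ y, ∃ d ∈ D, π y ∈ (d.1 : Set M)) ∧
      ∀ d ∈ D, (∀ y, π y ∈ (d.1 : Set M) → h y ∈ (d.2.1 ∪ d.2.2 : Set ℝ)) ∧
        ∀ s ∈ (d.2.1 ∪ d.2.2 : Set ℝ), ∀ t ∈ (d.2.1 ∪ d.2.2 : Set ℝ), s - t ≠ c := by
  classical
  -- Since `c > 1/2`, only the finitely many jumps of size at least `1/2` have to be avoided.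
  obtain ⟨c, hc, hcj⟩ : ∃ c : ℚ, c ∈ Set.Ioo (1 / 2 : ℚ) (3 / 4) ∧
      ∀ p ∈ twins π, |h p.1 - h p.2| ≠ c := by
    have hfin := ((finite_jumps hπc hπ hh (one_half_pos (α := ℝ))).image
      fun p => |h p.1 - h p.2|).preimage (f := fun q : ℚ => (q : ℝ)) Rat.cast_injective.injOn
    obtain ⟨c, hc, hcn⟩ := (Set.Ioo_infinite (show (1 / 2 : ℚ) < 3 / 4 by norm_num)).exists_notMem_finite
      hfin
    refine ⟨c, hc, fun p hp hpc => hcn ⟨p, ⟨hp, ?_⟩, hpc⟩⟩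
    rw [Real.dist_eq, hpc]
    have : ((1 / 2 : ℚ) : ℝ) < c := Rat.cast_lt.2 hc.1
    push_cast at this
    exact this.le
  have hc1 : (1 / 2 : ℝ) < c := by have : ((1 / 2 : ℚ) : ℝ) < c := Rat.cast_lt.2 hc.1; simpa using this
  have hc2 : (c : ℝ) < 3 / 4 := by have : (c : ℝ) < ((3 / 4 : ℚ) : ℝ) := Rat.cast_lt.2 hc.2; simpa using this
  have key : ∀ y : K, ∃ d : countableBasis M × countableBasis ℝ × countableBasis ℝ,
      π y ∈ (d.1 : Set M) ∧ (∀ z, π z ∈ (d.1 : Set M) → h z ∈ (d.2.1 ∪ d.2.2 : Set ℝ)) ∧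
        ∀ s ∈ (d.2.1 ∪ d.2.2 : Set ℝ), ∀ t ∈ (d.2.1 ∪ d.2.2 : Set ℝ), s - t ≠ c := by
    intro y
    obtain ⟨y', hy', hfib⟩ := exists_twin hπ y
    have hne : |h y - h y'| ≠ c := by
      rcases hy' with rfl | hy' | hy'
      · simp; linarith
      · exact hcj _ hy'
      · rw [abs_sub_comm]; exact hcj _ hy'
    -- Differences within one `δ`-ball are below `2δ ≤ c`; those between the two balls stay within
    -- `2δ` of `±(h y - h y')`, hence miss `c`.
    set δ := min |(|h y - h y'| - c)| c / 2 with hδ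
    have hδ0 : 0 < δ := by
      have := abs_pos.2 (sub_ne_zero.2 hne)
      have : (0 : ℝ) < c := by linarith
      positivity
    have hδ1 : 2 * δ ≤ |(|h y - h y'| - c)| := by
      rw [hδ, mul_div_cancel₀ _ two_ne_zero]; exact min_le_left _ _
    have hδ2 : 2 * δ ≤ c := by
      rw [hδ, mul_div_cancel₀ _ two_ne_zero]; exact min_le_right _ _
    obtain ⟨O, hO, hyO, hOb⟩ := (isBasis_countableBasis ℝ).exists_subset_of_mem_open
      (Metric.mem_ball_self (x := h y) hδ0) Metric.isOpen_ball
    obtain ⟨O', hO', hyO', hOb'⟩ := (isBasis_countableBasis ℝ).exists_subset_of_mem_open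
      (Metric.mem_ball_self (x := h y') hδ0) Metric.isOpen_ball
    obtain ⟨V, hV, hyV, hVW⟩ := exists_preimage_subset hπc (y := y) (W := h ⁻¹' (O ∪ O'))
      (((isOpen_of_mem_countableBasis hO).union (isOpen_of_mem_countableBasis hO')).preimage hh)
      (fun z hz => by
        rcases hfib z hz with rfl | rfl
        · exact Or.inl hyO
        · exact Or.inr hyO')
    obtain ⟨B, hB, hyB, hBV⟩ := (isBasis_countableBasis M).exists_subset_of_mem_open hyV hV
    refine ⟨(⟨B, hB⟩, ⟨O, hO⟩, ⟨O', hO'⟩), hyB, fun z hz => hVW (hBV hz), ?_⟩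
    intro s hs t ht hst
    have hb : ∀ {s : ℝ}, s ∈ O ∪ O' → |s - h y| < δ ∨ |s - h y'| < δ := fun hs =>
      hs.imp (fun h => by simpa [Real.dist_eq] using hOb h)
        (fun h => by simpa [Real.dist_eq] using hOb' h)
    rcases hb hs with hs | hs <;> rcases hb ht with ht | ht <;> rw [abs_lt] at hs ht
    · linarith
    · refine absurd hδ1 (not_le.2 ?_)
      have h1 : |(h y - h y') - c| < 2 * δ := abs_lt.2 ⟨by linarith, by linarith⟩
      refine lt_of_le_of_lt ?_ h1
      have := abs_abs_sub_abs_le_abs_sub (h y - h y') c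
      rwa [abs_of_pos (show (0 : ℝ) < c by linarith)] at this
    · refine absurd hδ1 (not_le.2 ?_)
      have h1 : |(h y' - h y) - c| < 2 * δ := abs_lt.2 ⟨by linarith, by linarith⟩
      refine lt_of_le_of_lt ?_ h1
      have := abs_abs_sub_abs_le_abs_sub (h y' - h y) c
      rwa [abs_of_pos (show (0 : ℝ) < c by linarith), abs_sub_comm (h y')] at this
    · linarith
  choose d hd1 hd2 hd3 using key
  obtain ⟨s, hs⟩ := isCompact_univ.elim_finite_subcover (fun y => π ⁻¹' (d y).1)
    (fun y => (isOpen_of_mem_countableBasis (d y).1.2).preimage hπc)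
    fun y _ => Set.mem_iUnion.2 ⟨y, hd1 y⟩
  refine ⟨c, s.image d, hc1, hc2, fun y => ?_, fun e he => ?_⟩
  · obtain ⟨z, hz, hyz⟩ := Set.mem_iUnion₂.1 (hs (Set.mem_univ y))
    exact ⟨d z, Finset.mem_image_of_mem d hz, hyz⟩
  · obtain ⟨z, -, rfl⟩ := Finset.mem_image.1 he
    exact ⟨hd2 z, hd3 z⟩

open TopologicalSpace in
/-- Among uncountably many functions with a unit jump, each at a place of its own, there are two
whose difference omits a value and still exceeds it somewhere. -/
theorem exists_sub_omits_value [SecondCountableTopology M] {π : K → M} (hπc : Continuous π)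
    (hπ : ∀ x y z, x < y → y < z → π x ≠ π z) {T : Set (K × K)} (hT : ¬ T.Countable)
    (hTπ : T ⊆ twins π) {h : K × K → K → ℝ} (hh : ∀ p ∈ T, Continuous (h p))
    (hjump : ∀ p ∈ T, h p p.2 - h p p.1 = 1) :
    ∃ p ∈ T, ∃ q ∈ T, ∃ c : ℝ, 1 / 2 < c ∧ c < 3 / 4 ∧ (∀ y, h p y - h q y ≠ c) ∧
      ∃ y, c < h p y - h q y := by
  -- The code `e` ranges over a countable type: `e.1` is the value `c` with its cover, `e.2` a basic
  -- neighbourhood of the twins with value sets left and right of the gap.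
  have key : ∀ p : K × K, p ∈ T → ∃ e : (ℚ ×
      Finset (countableBasis M × countableBasis ℝ × countableBasis ℝ)) ×
      countableBasis M × countableBasis ℝ × countableBasis ℝ,
      (1 / 2 < (e.1.1 : ℝ) ∧ (e.1.1 : ℝ) < 3 / 4 ∧
      (∀ y, ∃ d ∈ e.1.2, π y ∈ (d.1 : Set M)) ∧
      ∀ d ∈ e.1.2, (∀ y, π y ∈ (d.1 : Set M) → h p y ∈ (d.2.1 ∪ d.2.2 : Set ℝ)) ∧
        ∀ s ∈ (d.2.1 ∪ d.2.2 : Set ℝ), ∀ t ∈ (d.2.1 ∪ d.2.2 : Set ℝ), s - t ≠ e.1.1) ∧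
      π p.1 ∈ (e.2.1 : Set M) ∧ (∀ z, π z ∈ (e.2.1 : Set M) →
        (z ≤ p.1 → h p z ∈ (e.2.2.1 : Set ℝ)) ∧ (p.2 ≤ z → h p z ∈ (e.2.2.2 : Set ℝ))) ∧
      ∀ s ∈ (e.2.2.1 : Set ℝ), ∀ t ∈ (e.2.2.2 : Set ℝ), 3 / 4 < t - s := by
    intro p hp
    obtain ⟨c, D, hcD⟩ := exists_cover_of_jumps hπc hπ (hh p hp)
    -- Two errors of `1/8` leave more than `3/4` of the unit jump.
    have h8 : (0 : ℝ) < 1 / 8 := by norm_num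
    obtain ⟨O, hO, hyO, hOb⟩ := (isBasis_countableBasis ℝ).exists_subset_of_mem_open
      (Metric.mem_ball_self (x := h p p.1) h8) Metric.isOpen_ball
    obtain ⟨O', hO', hyO', hOb'⟩ := (isBasis_countableBasis ℝ).exists_subset_of_mem_open
      (Metric.mem_ball_self (x := h p p.2) h8) Metric.isOpen_ball
    obtain ⟨V, hV, hyV, hVW⟩ := exists_twin_nhds hπc hπ (hTπ hp)
      ((isOpen_of_mem_countableBasis hO).preimage (hh p hp))
      ((isOpen_of_mem_countableBasis hO').preimage (hh p hp)) hyO hyO'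
    obtain ⟨B, hB, hyB, hBV⟩ := (isBasis_countableBasis M).exists_subset_of_mem_open hyV hV
    refine ⟨((c, D), ⟨B, hB⟩, ⟨O, hO⟩, ⟨O', hO'⟩), hcD, hyB, fun z hz => hVW z (hBV hz), ?_⟩
    intro s hs t ht
    have h1 := hOb hs
    have h2 := hOb' ht
    rw [Metric.mem_ball, Real.dist_eq, abs_lt] at h1 h2
    linarith [hjump p hp]
  obtain ⟨p₀, hp₀⟩ : T.Nonempty := Set.nonempty_iff_ne_empty.2 fun h => hT (h ▸ Set.countable_empty)
  have := (key p₀ hp₀).nonempty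
  choose! e he using key
  have hninj : ¬ Set.InjOn e T := fun hinj =>
    hT (Set.countable_of_injective_of_countable_image hinj (Set.to_countable _))
  obtain ⟨p, hp, q, hq, hpq, hlt⟩ : ∃ p ∈ T, ∃ q ∈ T, e p = e q ∧ p.1 < q.1 := by
    unfold Set.InjOn at hninj
    push Not at hninj
    obtain ⟨p, hp, q, hq, hpq, hne⟩ := hninj
    rcases lt_trichotomy p.1 q.1 with h | h | h
    · exact ⟨p, hp, q, hq, hpq, h⟩
    · exact absurd (twins_ext_fst hπ (hTπ hp) (hTπ hq) h) hne
    · exact ⟨q, hq, p, hp, hpq.symm, h⟩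
  obtain ⟨⟨hc1, hc2, hcov, hD⟩, hpV, hV, hO⟩ := he p hp
  obtain ⟨⟨-, -, -, hD'⟩, -, hV', -⟩ := he q hq
  rw [← hpq] at hD' hV'
  refine ⟨p, hp, q, hq, (e p).1.1, hc1, hc2, fun y => ?_, p.2, ?_⟩
  · obtain ⟨d, hd, hyd⟩ := hcov y
    exact (hD d hd).2 _ ((hD d hd).1 y hyd) _ ((hD' d hd).1 y hyd)
  · have hle : p.2 ≤ q.1 := (twins_le_or_le hπ (hTπ hp) q.1).resolve_left (not_le.2 hlt)
    have hpV' : π p.2 ∈ ((e p).2.1 : Set M) := (hTπ hp).2 ▸ hpV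
    exact hc2.trans (hO _ ((hV' _ hpV').1 hle) _ ((hV _ hpV').2 le_rfl))

end Twins

/-! ### Countable separation, and uncountably many twins -/

section Separability

variable {K : Type*} [LinearOrder K] [TopologicalSpace K] [OrderClosedTopology K]

/-- In a perfect ordered space, every nonempty open interval has at least four points. -/
theorem exists_four_between [PerfectSpace K] {x y z : K} (hxy : x < y) (hyz : y < z) :
    ∃ a b c d, x < a ∧ a < b ∧ b < c ∧ c < d ∧ d < z := by
  have step : ∀ {x y z : K}, x < y → y < z → ∃ a b, x < a ∧ a < b ∧ b < z := by
    intro x y z hxy hyz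
    obtain ⟨w, ⟨hw, -⟩, hne⟩ := preperfect_iff_nhds.1 (PerfectSpace.univ_preperfect (α := K)) y
      trivial (Set.Ioo x z) (isOpen_Ioo.mem_nhds ⟨hxy, hyz⟩)
    rcases lt_or_gt_of_ne hne with h | h
    · exact ⟨w, y, hw.1, h, hyz⟩
    · exact ⟨y, w, hxy, h, hw.2⟩
  obtain ⟨a, b, h1, h2, h3⟩ := step hxy hyz
  obtain ⟨b, c, h4, h5, h6⟩ := step h2 h3
  obtain ⟨c, d, h7, h8, h9⟩ := step h5 h6
  exact ⟨a, b, c, d, h1, h4, h7, h8, h9⟩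

variable [CompactSpace K]

/-- A perfect compact ordered space with a monotone real function `F` that is not constant on any
nondegenerate interval admits a countable family of continuous functions that separate any two
nonadjacent points. -/
theorem exists_continuous_separating_nonadjacent [PerfectSpace K] {F : K → ℝ} (hF : Monotone F)
    (hF' : ∀ x y z, x < y → y < z → F x < F z) :
    ∃ π : K → (ℚ × ℚ → ℝ), Continuous π ∧ ∀ x y z, x < y → y < z → π x ≠ π z := by
  have key : ∀ q : ℚ × ℚ, ∃ g : K → ℝ, Continuous g ∧
      ((∃ a b, a < b ∧ (q.1 : ℝ) < F a ∧ F b < q.2) →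
        ∀ x, (F x ≤ q.1 → g x = 0) ∧ (q.2 ≤ F x → g x = 1)) := by
    intro q
    by_cases h : ∃ a b, a < b ∧ (q.1 : ℝ) < F a ∧ F b < q.2
    · obtain ⟨a, b, hab, ha, hb⟩ := h
      obtain ⟨g, hg0, hg1, -⟩ := exists_continuous_zero_one_of_isClosed (isClosed_Iic (a := a))
        (isClosed_Ici (a := b)) (Set.disjoint_left.2 fun x hx hx' =>
          not_le.2 hab (le_trans hx' hx))
      -- `F` need not be continuous; monotonicity alone places its sublevel and superlevel sets
      -- inside `Iic a` and `Ici b`.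
      refine ⟨g, g.continuous, fun _ x => ⟨fun hx => hg0 ?_, fun hx => hg1 ?_⟩⟩
      · exact (hF.reflect_lt (hx.trans_lt ha)).le
      · exact (hF.reflect_lt (hb.trans_le hx)).le
    · exact ⟨0, continuous_zero, fun h' => (h h').elim⟩
  choose g hgc hg using key
  refine ⟨fun x q => g q x, continuous_pi hgc, fun x y z hxy hyz heq => ?_⟩
  -- `F` is strict only across an intermediate point: `a` and `d` serve to give `F x < F b` and `F c
  -- < F z`, while `b < c` witness the condition for the rational pair.
  obtain ⟨a, b, c, d, h1, h2, h3, h4, h5⟩ := exists_four_between hxy hyz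
  obtain ⟨q, hq1, hq2⟩ := exists_rat_btwn (hF' _ _ _ h1 h2)
  obtain ⟨q', hq1', hq2'⟩ := exists_rat_btwn (hF' _ _ _ h4 h5)
  have h := hg (q, q') ⟨b, c, h3, hq2, hq1'⟩
  have := congrFun heq (q, q')
  simp only [(h x).1 hq1.le, (h z).2 hq2'.le] at this
  exact zero_ne_one this

variable {M : Type*} [TopologicalSpace M] [PolishSpace M]

/-- In a perfect compact ordered space without Cantor subsets, a continuous map into a Polish space
that separates nonadjacent points has uncountably many twins in every nonempty open set. -/
theorem not_countable_twins [PerfectSpace K] {π : K → M} (hπc : Continuous π)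
    (hC : ¬ ∃ f : (ℕ → Bool) → K, Continuous f ∧ Function.Injective f) {V : Set K} (hV : IsOpen V)
    (hVne : V.Nonempty) : ¬ {p | p ∈ twins π ∧ p.1 ∈ V ∧ p.2 ∈ V}.Countable := by
  intro hcount
  set T := {p | p ∈ twins π ∧ p.1 ∈ V ∧ p.2 ∈ V} with hT
  have : Countable T := hcount.to_subtype
  have key : ∀ p : T, ∃ g : K → ℝ, Continuous g ∧ g p.1.1 ≠ g p.1.2 := by
    rintro ⟨p, ⟨hp, -⟩, -⟩
    obtain ⟨g, hg0, hg1, -⟩ := exists_continuous_zero_one_of_isClosed (isClosed_singleton (x := p.1))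
      (isClosed_singleton (x := p.2)) (by simpa using hp.ne)
    refine ⟨g, g.continuous, ?_⟩
    rw [hg0 (Set.mem_singleton _), hg1 (Set.mem_singleton _)]
    exact zero_ne_one
  choose g hgc hg using key
  -- One extra function for each pair of twins in `V` makes the map injective on `V`; countability
  -- of `T` keeps the target Polish.
  let ψ : K → M × (T → ℝ) := fun x => (π x, fun p => g p x)
  have hψ : Continuous ψ := hπc.prodMk (continuous_pi hgc)
  have hinj : Set.InjOn ψ V := by
    have : ∀ x ∈ V, ∀ y ∈ V, ψ x = ψ y → ¬ x < y := fun x hx y hy hxy hlt =>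
      hg ⟨(x, y), ⟨hlt, congrArg Prod.fst hxy⟩, hx, hy⟩
        (congrFun (congrArg Prod.snd hxy) ⟨(x, y), ⟨hlt, congrArg Prod.fst hxy⟩, hx, hy⟩)
    intro x hx y hy hxy
    exact le_antisymm (not_lt.1 (this y hy x hx hxy.symm)) (not_lt.1 (this x hx y hy hxy))
  obtain ⟨x, hx⟩ := hVne
  obtain ⟨N, hN, hNcl, hNV⟩ := exists_mem_nhds_isClosed_subset (hV.mem_nhds hx)
  -- The closure of an open set inherits perfectness, which `N` itself might lack.
  have hperf := (isOpen_interior (s := N)).perfect_closure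
  have hsub : closure (interior N) ⊆ V := (hNcl.closure_interior_subset).trans hNV
  have hemb : IsClosedEmbedding fun y : closure (interior N) => ψ y := by
    have : CompactSpace (closure (interior N)) := isCompact_iff_compactSpace.1 hperf.1.isCompact
    exact (hψ.comp continuous_subtype_val).isClosedEmbedding fun a b hab =>
      Subtype.ext (hinj (hsub a.2) (hsub b.2) hab)
  have : PolishSpace (closure (interior N)) := hemb.polishSpace
  let := TopologicalSpace.upgradeIsCompletelyMetrizable (closure (interior N))
  have hps : PerfectSpace (closure (interior N)) := by
    refine ⟨preperfect_iff_nhds.2 fun y _ W hW => ?_⟩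
    obtain ⟨W', hW', hsubW⟩ := mem_nhds_subtype _ _ _ |>.1 hW
    obtain ⟨w, ⟨hw, hwN⟩, hne⟩ := preperfect_iff_nhds.1 hperf.2 y y.2 W' hW'
    exact ⟨⟨w, hwN⟩, ⟨hsubW hw, trivial⟩, fun h => hne (congrArg Subtype.val h)⟩
  obtain ⟨f, -, hfc, hfi⟩ := (PerfectSpace.univ_perfect
    (α := closure (interior N))).exists_nat_bool_injection
    ⟨⟨x, subset_closure (mem_interior_iff_mem_nhds.2 hN)⟩, trivial⟩
  exact hC ⟨fun s => f s, continuous_subtype_val.comp hfc, Subtype.val_injective.comp hfi⟩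

end Separability

/-- A continuous injection of the Cantor space yields a Cantor subset. -/
theorem containsCantorSubset_of_injective {H : Type*} [TopologicalSpace H] [T2Space H]
    {f : (ℕ → Bool) → H} (hf : Continuous f) (hfi : Function.Injective f) :
    ContainsCantorSubset H :=
  ⟨Set.range f, ⟨((hf.isClosedEmbedding hfi).isEmbedding.toHomeomorph.symm).trans
    cantorSetHomeomorphNatToBool.symm⟩⟩

/-! ### Algebras that peak in every open set -/

section Peaks

variable {X : Type*} [TopologicalSpace X] [CompactSpace X]

/-- Every nonempty open set contains a point where some `f ∈ A` is larger in modulus than anywhere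
outside: no proper closed subset is a boundary. -/
def PeaksEverywhere (A : Subalgebra ℂ C(X, ℂ)) : Prop :=
  ∀ V : Set X, IsOpen V → V.Nonempty → ∃ f ∈ A, ∃ x ∈ V, ∀ y ∉ V, ‖f y‖ < ‖f x‖

variable {A : Subalgebra ℂ C(X, ℂ)}

/-- Divide by the value at a maximum of `|f|`, which must lie in `V`; the point `z` outside makes it
nonzero. Compactness of the complement gives `r < 1`. -/
theorem PeaksEverywhere.exists_normalized (hA : PeaksEverywhere A) {V : Set X} (hV : IsOpen V)
    (hne : V.Nonempty) {z : X} (hz : z ∉ V) :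
    ∃ g ∈ A, (∀ x, ‖g x‖ ≤ 1) ∧ (∃ x ∈ V, g x = 1) ∧
      ∃ r : ℝ, 0 ≤ r ∧ r < 1 ∧ ∀ y ∉ V, ‖g y‖ ≤ r := by
  obtain ⟨f, hfA, x₀, -, hf⟩ := hA V hV hne
  obtain ⟨x, -, hx⟩ := isCompact_univ.exists_isMaxOn (s := (Set.univ : Set X)) ⟨z, trivial⟩
    f.continuous.norm.continuousOn
  have hmax : ∀ y, ‖f y‖ ≤ ‖f x‖ := fun y => hx (Set.mem_univ y)
  have hlt : ∀ y ∉ V, ‖f y‖ < ‖f x‖ := fun y hy => (hf y hy).trans_le (hmax x₀)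
  have hpos : 0 < ‖f x‖ := (norm_nonneg _).trans_lt (hlt z hz)
  have hval : ∀ y, ‖((f x)⁻¹ • f) y‖ = ‖f y‖ / ‖f x‖ := by
    intro y
    simp [div_eq_inv_mul]
  obtain ⟨w, hw, hwmax⟩ := hV.isClosed_compl.isCompact.exists_isMaxOn ⟨z, hz⟩
    f.continuous.norm.continuousOn
  refine ⟨(f x)⁻¹ • f, A.smul_mem hfA _, fun y => ?_,
    ⟨x, by_contra fun h => (hlt x h).false, by simp [norm_pos_iff.1 hpos]⟩,
    ‖f w‖ / ‖f x‖, by positivity, (div_lt_one hpos).2 (hlt w hw), fun y hy => ?_⟩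
  · rw [hval]
    exact div_le_one_of_le₀ (hmax y) hpos.le
  · rw [hval]
    gcongr
    exact hwmax hy

/-- A normalized peak function at an isolated point has real part `1` there and at most `r`
elsewhere, so it omits `(1 + r) / 2` while lying on both sides. -/
theorem PeaksEverywhere.not_isOpen_singleton (hA : PeaksEverywhere A)
    (hAc : IsClosed (A : Set C(X, ℂ))) (hI : OnlyTrivialIdempotents A) {x z : X} (hxz : z ≠ x) :
    ¬ IsOpen ({x} : Set X) := by
  intro hx
  obtain ⟨g, hgA, -, ⟨x', hx', hgx⟩, r, -, hr1, hr⟩ :=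
    hA.exists_normalized hx ⟨x, rfl⟩ (z := z) hxz
  rw [Set.mem_singleton_iff.1 hx'] at hgx
  have hle : ∀ y ≠ x, (g y).re < (1 + r) / 2 := fun y hy => by
    have := (Complex.re_le_norm _).trans (hr y hy)
    linarith
  rcases hI.re_lt_or_lt hAc hgA (c := (1 + r) / 2) fun y => by
      rcases eq_or_ne y x with rfl | hy
      · rw [hgx, Complex.one_re]
        intro h
        linarith
      · exact (hle y hy).ne with h | h
  · have := h x
    rw [hgx, Complex.one_re] at this
    linarith
  · exact lt_asymm (h z) (hle z hxz)

theorem PeaksEverywhere.perfectSpace_closure (hA : PeaksEverywhere A)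
    (hAc : IsClosed (A : Set C(X, ℂ))) (hI : OnlyTrivialIdempotents A) {U : Set X} (hU : IsOpen U)
    {z : X} (hz : z ∉ U) : PerfectSpace (closure U) := by
  refine ⟨preperfect_iff_nhds.2 fun y _ W hW => ?_⟩
  obtain ⟨W', hW', hsub⟩ := mem_nhds_subtype _ _ _ |>.1 hW
  obtain ⟨O, hOW, hO, hyO⟩ := mem_nhds_iff.1 hW'
  obtain ⟨u, huO, huU⟩ := mem_closure_iff.1 y.2 O hO hyO
  obtain ⟨u', ⟨hu'O, hu'U⟩, hne⟩ : ∃ u' ∈ O ∩ U, u' ≠ u := by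
    by_contra! h
    have : O ∩ U = {u} := Set.eq_singleton_iff_unique_mem.2 ⟨⟨huO, huU⟩, h⟩
    exact hA.not_isOpen_singleton hAc hI (x := u) (z := z) (fun h => hz (h ▸ huU))
      (this ▸ hO.inter hU)
  by_cases hy : u = y
  · exact ⟨⟨u', subset_closure hu'U⟩, ⟨hsub (hOW hu'O), trivial⟩, fun h =>
      hne ((congrArg Subtype.val h).trans hy.symm)⟩
  · exact ⟨⟨u, subset_closure huU⟩, ⟨hsub (hOW huO), trivial⟩, fun h => hy (congrArg Subtype.val h)⟩

/-- From a function of `A` that separates two points, and one that is small off `U` but not at the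
two points, we obtain a function that is small off `U` and differs by `1` at the two points. -/
theorem exists_unit_jump {U : Set X} {G f : C(X, ℂ)} (hG : G ∈ A) (hf : f ∈ A)
    (hGU : ∀ y ∉ U, ‖G y‖ ≤ 1 / 8) {a b : X} (ha : 1 / 2 < ‖G a‖) (hab : G a = G b)
    (hfab : f a ≠ f b) : ∃ h ∈ A, h b - h a = 1 ∧ ∀ y ∉ U, ‖h y‖ ≤ 1 / 8 := by
  have hJ : f b - f a ≠ 0 := sub_ne_zero.2 hfab.symm
  have hJ' := norm_pos_iff.2 hJ
  have hGa : G a ≠ 0 := norm_pos_iff.1 (by linarith)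
  -- Off `U` the quotient `|G| / |G a|` is below `1/4`, so multiplying `f` by `(G / G a) ^ m` beats
  -- the factor `‖f‖ / ‖f b - f a‖`. As `G a = G b`, the jump of `f` survives intact.
  obtain ⟨m, hm⟩ := exists_pow_lt_of_lt_one
    (show 0 < ‖f b - f a‖ / (8 * (‖f‖ + 1)) by positivity) (show (1 / 4 : ℝ) < 1 by norm_num)
  rw [lt_div_iff₀ (by positivity)] at hm
  refine ⟨((f b - f a) * G a ^ m)⁻¹ • (f * G ^ m),
    A.smul_mem (A.mul_mem hf (A.pow_mem hG m)) _, ?_, fun y hy => ?_⟩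
  · simp only [ContinuousMap.coe_smul, Pi.smul_apply, ContinuousMap.coe_mul, Pi.mul_apply,
      ContinuousMap.coe_pow, Pi.pow_apply, smul_eq_mul, ← hab]
    field_simp
  · simp only [ContinuousMap.coe_smul, Pi.smul_apply, ContinuousMap.coe_mul, Pi.mul_apply,
      ContinuousMap.coe_pow, Pi.pow_apply, smul_eq_mul, norm_mul, norm_inv, norm_pow]
    rw [inv_mul_le_iff₀ (by positivity)]
    have h1 : ‖f y‖ * ‖G y‖ ^ m ≤ ‖f‖ * (1 / 8) ^ m := by
      gcongr
      · exact f.norm_coe_le_norm y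
      · exact hGU y hy
    have h2 : ‖f b - f a‖ * (1 / 2) ^ m ≤ ‖f b - f a‖ * ‖G a‖ ^ m := by gcongr
    have h3 : ((1 : ℝ) / 8) ^ m = (1 / 4) ^ m * (1 / 2) ^ m := by rw [← mul_pow]; norm_num
    have h4 : (0 : ℝ) < (1 / 2) ^ m := by positivity
    have h5 : (0 : ℝ) < (1 / 4) ^ m := by positivity
    rw [h3] at h1
    nlinarith [mul_le_mul_of_nonneg_right hm.le h4.le, mul_pos h4 h5]

/-- The core of the argument: a proper open set whose closure carries a suitable order without
Cantor subsets cannot consist of points of the Šilov boundary. -/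
theorem PeaksEverywhere.eq_empty_of_order [T2Space X] (hA : PeaksEverywhere A)
    (hfa : IsFunctionAlgebra A) (hI : OnlyTrivialIdempotents A) {U : Set X} (hU : IsOpen U)
    {z : X} (hz : z ∉ U) [LinearOrder (closure U)] [OrderClosedTopology (closure U)]
    {F : closure U → ℝ} (hF : Monotone F) (hF' : ∀ x y z, x < y → y < z → F x < F z)
    (hC : ¬ ∃ f : (ℕ → Bool) → closure U, Continuous f ∧ Function.Injective f) : U = ∅ := by
  by_contra hne
  have hne := Set.nonempty_iff_ne_empty.2 hne
  have hAc := hfa.isClosed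
  have : CompactSpace (closure U) := isCompact_iff_compactSpace.1 isClosed_closure.isCompact
  have := hA.perfectSpace_closure hAc hI hU hz
  obtain ⟨π, hπc, hπ⟩ := exists_continuous_separating_nonadjacent hF hF'
  obtain ⟨g, hgA, hg1, ⟨x, hxU, hgx⟩, r, hr0, hr1, hr⟩ := hA.exists_normalized hU hne hz
  obtain ⟨k, hk⟩ := exists_pow_lt_of_lt_one (show (0 : ℝ) < 1 / 8 by norm_num) hr1
  set G := g ^ k with hG
  have hGA : G ∈ A := A.pow_mem hgA k
  have hGU : ∀ y ∉ U, ‖G y‖ ≤ 1 / 8 := fun y hy => by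
    rw [hG, ContinuousMap.pow_apply, norm_pow]
    exact (pow_le_pow_left₀ (norm_nonneg _) (hr y hy) k).trans hk.le
  have hV : IsOpen {y : closure U | (y : X) ∈ U ∧ 1 / 2 < ‖G y‖} :=
    (hU.preimage continuous_subtype_val).inter 
      (isOpen_lt continuous_const (G.continuous.norm.comp continuous_subtype_val))
  have hVne : {y : closure U | (y : X) ∈ U ∧ 1 / 2 < ‖G y‖}.Nonempty :=
    ⟨⟨x, subset_closure hxU⟩, hxU, by simp [hG, hgx]; norm_num⟩
  have hunc := not_countable_twins hπc hC hV hVne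
  set V := {y : closure U | (y : X) ∈ U ∧ 1 / 2 < ‖G y‖}
  -- `G` jumps across only countably many twins; discarding these leaves uncountably many.
  have hT : ¬ {p | (p ∈ twins π ∧ p.1 ∈ V ∧ p.2 ∈ V) ∧ G p.1 = G p.2}.Countable := by
    intro hc
    refine hunc ((hc.union (countable_jumps hπc hπ (h := fun y : closure U => G y)
      (by fun_prop))).mono fun p hp => ?_)
    by_cases h : G p.1 = G p.2
    · exact Or.inl ⟨hp, h⟩
    · exact Or.inr ⟨hp.1, h⟩
  have key : ∀ p ∈ {p | (p ∈ twins π ∧ p.1 ∈ V ∧ p.2 ∈ V) ∧ G p.1 = G p.2},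
      ∃ h ∈ A, h p.2 - h p.1 = 1 ∧ ∀ y ∉ U, ‖h y‖ ≤ 1 / 8 := by
    rintro p ⟨⟨hp, hp1, hp2⟩, hGp⟩
    obtain ⟨_, ⟨f, hf, rfl⟩, hfne⟩ := hfa.separatesPoints
      (show (p.1 : X) ≠ p.2 from fun h => hp.1.ne (Subtype.ext h))
    exact exists_unit_jump hGA hf hGU hp1.2 hGp hfne
  choose! h hhA hhj hhU using key
  obtain ⟨p, hp, q, hq, c, hc1, hc2, hne, y, hy⟩ := exists_sub_omits_value hπc hπ hT
    (fun p hp => hp.1.1) (h := fun p y => (h p y).re) (fun p _ => by fun_prop)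
    (fun p hp => by
      have := congrArg Complex.re (hhj p hp)
      simpa using this)
  -- Off `U` the difference is at most `1/8 + 1/8 < 1/2 < c`.
  have hsmall : ∀ w ∉ U, ((h p - h q) w).re < c := fun w hw => by
    have h1 := (Complex.re_le_norm ((h p - h q) w)).trans (norm_sub_le (h p w) (h q w))
    linarith [hhU p hp w hw, hhU q hq w hw]
  rcases hI.re_lt_or_lt hAc (A.sub_mem (hhA p hp) (hhA q hq)) (c := c) fun w => by
      by_cases hw : w ∈ U
      · exact hne ⟨w, subset_closure hw⟩
      · exact (hsmall w hw).ne with h | h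
  · exact lt_asymm (h y) hy
  · exact lt_asymm (h z) (hsmall z hz)

end Peaks

/-! ### Restriction to the Šilov boundary -/

section Restriction

variable {X : Type*} [TopologicalSpace X]

/-- The algebra of the restrictions to `Y` of the functions in `A`. -/
noncomputable def restrictAlgebra (A : Subalgebra ℂ C(X, ℂ)) (Y : Set X) : Subalgebra ℂ C(Y, ℂ) :=
  A.map (ContinuousMap.compRightAlgHom ℂ ℂ ⟨Subtype.val, continuous_subtype_val⟩)

variable {A : Subalgebra ℂ C(X, ℂ)} {Y : Set X}

theorem mem_restrictAlgebra {g : C(Y, ℂ)} :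
    g ∈ restrictAlgebra A Y ↔ ∃ f ∈ A, f.restrict Y = g := Iff.rfl

theorem restrict_mem_restrictAlgebra {f : C(X, ℂ)} (hf : f ∈ A) :
    f.restrict Y ∈ restrictAlgebra A Y := ⟨f, hf, rfl⟩

variable [CompactSpace X]

/-- Restriction to a boundary is isometric on `A`, so its image is complete and hence closed. -/
theorem IsFunctionAlgebra.restrict (hA : IsFunctionAlgebra A) (hY : IsBoundary A Y) :
    let : CompactSpace Y := isCompact_iff_compactSpace.1 hY.1.isCompact
    IsFunctionAlgebra (restrictAlgebra A Y) := by
  let : CompactSpace Y := isCompact_iff_compactSpace.1 hY.1.isCompact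
  refine ⟨fun x y hxy => ?_, ?_⟩
  · obtain ⟨_, ⟨f, hf, rfl⟩, hne⟩ := hA.separatesPoints (fun h => hxy (Subtype.ext h))
    exact ⟨_, ⟨_, restrict_mem_restrictAlgebra hf, rfl⟩, hne⟩
  · have hcomplete : CompleteSpace A := hA.isClosed.completeSpace_coe
    have hiso : Isometry fun f : A => (f : C(X, ℂ)).restrict Y := by
      refine Isometry.of_dist_eq fun f g => ?_
      refine le_antisymm ((ContinuousMap.dist_le dist_nonneg).2 fun x =>
        ContinuousMap.dist_apply_le_dist x.1) ?_
      refine (ContinuousMap.dist_le dist_nonneg).2 fun x => ?_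
      obtain ⟨y, hy, hxy⟩ := ((isBoundary_iff A Y).1 hY).2 (f - g : A) (Subtype.mem _) x
      have h1 := ContinuousMap.dist_apply_le_dist (f := (f : C(X, ℂ)).restrict Y)
        (g := (g : C(X, ℂ)).restrict Y) ⟨y, hy⟩
      rw [dist_eq_norm] at h1 ⊢
      exact hxy.trans h1
    have hr : Set.range (fun f : A => (f : C(X, ℂ)).restrict Y) = restrictAlgebra A Y := by
      ext g
      simp [mem_restrictAlgebra]
    rw [← hr]
    exact hiso.isUniformInducing.isComplete_range.isClosed

/-- If `e² - e` vanishes on a boundary, it vanishes everywhere. -/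
theorem OnlyTrivialIdempotents.restrict (hI : OnlyTrivialIdempotents A) (hY : IsBoundary A Y) :
    OnlyTrivialIdempotents (restrictAlgebra A Y) := by
  rintro _ ⟨e, he, rfl⟩ hee
  have hee' : e * e = e := by
    ext x
    obtain ⟨y, hy, hxy⟩ := ((isBoundary_iff A Y).1 hY).2 _ (A.sub_mem (A.mul_mem he he) he) x
    have h0 : (e * e - e) y = 0 := sub_eq_zero.2 (congrArg (fun g : C(Y, ℂ) => g ⟨y, hy⟩) hee)
    rw [h0, norm_zero, norm_le_zero_iff] at hxy
    exact sub_eq_zero.1 hxy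
  rcases hI e he hee' with rfl | rfl
  · exact Or.inl (map_zero _)
  · exact Or.inr (map_one _)

/-- By minimality, deleting `V` from the Šilov boundary leaves no boundary. A function witnessing
this attains its maximum modulus on the Šilov boundary, necessarily in `V`. -/
theorem peaksEverywhere_restrict_silovBoundary (hA : A.SeparatesPoints) :
    PeaksEverywhere (restrictAlgebra A (silovBoundary A)) := by
  have hY := (isLeast_silovBoundary A hA).1
  intro V hV hne
  have hcl : IsClosed (Subtype.val '' Vᶜ : Set X) :=
    hY.1.isClosedEmbedding_subtypeVal.isClosedMap _ hV.isClosed_compl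
  have hnot : ¬ IsBoundary A (Subtype.val '' Vᶜ) := by
    intro hb
    obtain ⟨x, hx⟩ := hne
    obtain ⟨y, hy, hyx⟩ := Set.sInter_subset_of_mem hb x.2
    exact hy (Subtype.ext hyx ▸ hx)
  rw [isBoundary_iff] at hnot
  push Not at hnot
  obtain ⟨f, hf, x, hx⟩ := hnot hcl
  obtain ⟨y, hy, hxy⟩ := ((isBoundary_iff A _).1 hY).2 f hf x
  have hlt : ∀ w ∉ V, ‖f w‖ < ‖f y‖ := fun w hw => (hx w ⟨w, hw, rfl⟩).trans_le hxy
  exact ⟨f.restrict _, restrict_mem_restrictAlgebra hf, ⟨y, hy⟩,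
    by_contra fun h => (hlt ⟨y, hy⟩ h).false, hlt⟩

/-- If the Šilov boundary meets a proper open set, then it has a point other than any given one. -/
theorem exists_ne_mem_silovBoundary (hA : A.SeparatesPoints) {U : Set X} (hU : U ≠ Set.univ) {y : X}
    (hy : y ∈ U) : ∃ z ∈ silovBoundary A, z ≠ y := by
  by_contra! hcon
  refine hU (Set.eq_univ_of_forall fun x => ?_)
  suffices x = y from this ▸ hy
  by_contra hxy
  obtain ⟨_, ⟨f, hf, rfl⟩, hne⟩ := hA hxy
  obtain ⟨w, hw, hxw⟩ := ((isBoundary_iff A _).1 (isLeast_silovBoundary A hA).1).2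
    (f - f y • (1 : C(X, ℂ))) (A.sub_mem hf (A.smul_mem A.one_mem _)) x
  rw [hcon w hw] at hxw
  have h0 : f x - f y = 0 := by simpa using hxw
  exact hne (sub_eq_zero.1 h0)

end Restriction

/-! ### Removability from an order and a distribution function -/

section Removable

/-- A compact space that injects continuously into a linearly ordered space is removable, provided
that it contains no Cantor set and some monotone real function separates its nonadjacent points. -/
theorem isRemovable_of_order {L : Type*} [LinearOrder L] [TopologicalSpace L] [OrderTopology L]
    {H : Type u} [TopologicalSpace H] [CompactSpace H] {i : H → L} (hi : Continuous i)
    (hinj : Function.Injective i) {F : L → ℝ} (hF : Monotone F)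
    (hF' : ∀ x y z : H, i x < i y → i y < i z → F (i x) < F (i z))
    (hC : ¬ ∃ f : (ℕ → Bool) → L, Continuous f ∧ Function.Injective f) : IsRemovable.{u, v} H := by
  refine ⟨inferInstance, T2Space.of_injective_continuous hinj hi, ?_⟩
  rintro X _ _ _ U A hU hne ⟨K, ⟨φ⟩⟩ hA hI y hy hyU
  obtain ⟨z, hz, hzy⟩ := exists_ne_mem_silovBoundary hA.separatesPoints hne hyU
  have hB := (isLeast_silovBoundary A hA.separatesPoints).1
  have : CompactSpace (silovBoundary A) := isCompact_iff_compactSpace.1 hB.1.isCompact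
  -- Deleting `z` makes `U'` proper even if `U` contains the whole Šilov boundary; `y ≠ z` remains
  -- in it.
  let U' : Set (silovBoundary A) := {w | (w : X) ∈ U ∧ (w : X) ≠ z}
  have hU' : IsOpen U' := (hU.preimage continuous_subtype_val).inter
    (isOpen_ne.preimage continuous_subtype_val)
  have hmem : ∀ w : closure U', (w : X) ∈ closure U := fun w =>
    map_mem_closure continuous_subtype_val w.2 fun _ h => h.1
  let e : closure U' → H := fun w => φ ⟨w, hmem w⟩
  have he : Continuous e := by fun_prop
  have heinj : Function.Injective e := fun a b hab =>
    Subtype.ext (Subtype.ext (Subtype.mk.inj (φ.injective (Subtype.ext hab))))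
  -- The order is pulled back from `L`. The topology need not be its order topology; closedness of
  -- `≤` is enough.
  let : LinearOrder (closure U') := LinearOrder.lift' (i ∘ e) (hinj.comp heinj)
  have : OrderClosedTopology (closure U') :=
    ⟨isClosed_le (f := fun p : closure U' × closure U' => i (e p.1)) (g := fun p => i (e p.2))
      ((hi.comp he).comp continuous_fst) ((hi.comp he).comp continuous_snd)⟩
  have hempty := (peaksEverywhere_restrict_silovBoundary hA.separatesPoints).eq_empty_of_order
    (hA.restrict hB) (hI.restrict hB) hU' (z := ⟨z, hz⟩) (fun h => h.2 rfl)
    (F := fun w => F (i (e w))) (fun a b hab => hF hab) (fun a b c hab hbc => hF' _ _ _ hab hbc)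
    (fun ⟨f, hf, hfi⟩ => hC ⟨_, (hi.comp he).comp hf, (hinj.comp heinj).comp hfi⟩)
  have : (⟨y, hy⟩ : silovBoundary A) ∈ U' := ⟨hyU, hzy.symm⟩
  rw [hempty] at this
  exact this

/-- The distribution function of a finite measure separates the nonadjacent points of its support. -/
theorem measureReal_Iic_lt {L : Type*} [LinearOrder L] [TopologicalSpace L] [OrderTopology L]
    [MeasurableSpace L] [BorelSpace L] (μ : Measure L) [IsFiniteMeasure μ] {x y z : L}
    (hy : y ∈ μ.support) (hxy : x < y) (hyz : y < z) :
    μ.real (Set.Iic x) < μ.real (Set.Iic z) := by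
  have hpos := (Measure.mem_support_iff_forall y).1 hy _ (isOpen_Ioo.mem_nhds ⟨hxy, hyz⟩)
  have hpos' : 0 < μ.real (Set.Ioo x z) := ENNReal.toReal_pos hpos.ne' (measure_ne_top _ _)
  have hunion := measureReal_union (μ := μ) (s₁ := Set.Iic x) (s₂ := Set.Ioo x z)
    (Set.disjoint_left.2 fun w hw hw' => not_lt.2 hw hw'.1) isOpen_Ioo.measurableSet
  have hmono : μ.real (Set.Iic x ∪ Set.Ioo x z) ≤ μ.real (Set.Iic z) :=
    measureReal_mono (Set.union_subset (Set.Iic_subset_Iic.2 (hxy.trans hyz).le)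
      fun w hw => hw.2.le)
  linarith

end Removable

end FunctionAlgebra

theorem mainTheorem5 (L : Type u) [LinearOrder L] [TopologicalSpace L] [OrderTopology L]
    [CompactSpace L] [MeasurableSpace L] [BorelSpace L]
    (hL : ¬ FunctionAlgebra.ContainsCantorSubset L) :
    FunctionAlgebra.IsPseudoRemovable.{u, v} L := by
  refine ⟨inferInstance, inferInstance, fun μ hμ => ?_⟩
  have : CompactSpace (FunctionAlgebra.complexSupport μ) :=
    isCompact_iff_compactSpace.1 (Measure.isClosed_support (μ := μ.variation)).isCompact
  exact FunctionAlgebra.isRemovable_of_order continuous_subtype_val Subtype.val_injective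
    (F := fun x => μ.variation.real (Set.Iic x))
    (fun x y hxy => measureReal_mono (Set.Iic_subset_Iic.2 hxy))
    (fun x y z hxy hyz => FunctionAlgebra.measureReal_Iic_lt μ.variation y.2 hxy hyz)
    fun ⟨f, hf, hfi⟩ => hL (FunctionAlgebra.containsCantorSubset_of_injective hf hfi)
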